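/- Let $q$ be a complex number with $|q|<1$, and write $(a;q)_n:=\prod_{j=0}^{n-1}(1-aq^j)$ for $n\in\mathbb N_0\cup\{\infty\}$. Let $$F^{\rm od}_{\rm ed}(q):=\sum_{n=0}^\infty q^{2n+2}(-q^2;q^2)_n(-q^{2n+3};q^2)_\infty,\qquad F^{\rm ed}_{\rm od}(q):=\sum_{n=0}^\infty q^{2n+1}(-q;q^2)_n(-q^{2n+2};q^2)_\infty,$$ $$F^{\rm ed}_{\rm ou}(q):=\sum_{n=0}^\infty \frac{q^{2n+1}(-q^{2n+2};q^2)_\infty}{(q;q^2)_{n+1}}$$ be Andrews' generating functions of partitions with parts separated by parity: the superscript describes the larger parts and the subscript the smaller parts, where "ed" stands for distinct even parts, "od" for distinct odd parts, "ou" for odd parts with repetition allowed, and there is at least one smaller part. These three series converge absolutely for $|q|<1$, and the following identities hold: $$F^{\rm od}_{\rm ed}(q)=\frac{q(-q;q^2)_\infty}{1-q}\left(1-\frac{(-q^2;q^2)_\infty}{(-q;q^2)_\infty}\right),\tag{1}$$ $$F^{\rm ed}_{\rm od}(q)=\frac{q(-q^2;q^2)_\infty}{1-q}\left(2-\frac{(-q;q^2)_\infty}{(-q^2;q^2)_\infty}\right),\tag{2}$$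 and, for $q\neq 0$, $$F^{\rm ed}_{\rm ou}(-q)=-\frac{(-q^2;q^2)_\infty}{2}\left(2-\frac{1}{(-q;q)_\infty}-\frac{2}{(q;q)_\infty}\sum_{n\in\mathbb Z}\frac{(-1)^nq^{\frac{3n(n+1)}{2}}}{1+q^n}\right),\tag{3}$$ where the sum over $n\in\mathbb Z$ converges absolutely. -/

import Mathlib

noncomputable section

/-- The finite `q`-Pochhammer symbol `(a; q)_n = ∏_{j=0}^{n-1} (1 - a q^j)`. -/
def qPoch (a q : ℂ) (n : ℕ) : ℂ := ∏ j ∈ Finset.range n, (1 - a * q ^ j)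

/-- The infinite `q`-Pochhammer symbol `(a; q)_∞ = ∏_{j=0}^∞ (1 - a q^j)`, used for `‖q‖ < 1`. -/
def qPochInf (a q : ℂ) : ℂ := ∏' j : ℕ, (1 - a * q ^ j)

/-- The product defining `(a; q)_∞` converges for every `a` whenever `‖q‖ < 1`. -/
theorem multipliable_qPochInf (a q : ℂ) (hq : ‖q‖ < 1) :
    Multipliable fun j : ℕ => 1 - a * q ^ j := by
  have h : Summable fun j : ℕ => ‖-(a * q ^ j)‖ := by
    simp only [norm_neg, norm_mul, norm_pow]
    exact (summable_geometric_of_lt_one (norm_nonneg q) hq).mul_left _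
  simpa [sub_eq_add_neg] using multipliable_one_add_of_summable h

/-- The `n`-th term `q^{2n+2} (-q^2; q^2)_n (-q^{2n+3}; q^2)_∞` of `F^{od}_{ed}(q)`. -/
def odedTerm (q : ℂ) (n : ℕ) : ℂ :=
  q ^ (2 * n + 2) * qPoch (-q ^ 2) (q ^ 2) n * qPochInf (-q ^ (2 * n + 3)) (q ^ 2)

/-- `F^{od}_{ed}(q)`: generating function of the partitions into distinct parts, at least one of
them even, in which every even part is smaller than every odd part (`2n+2` is the largest even
part). -/
def Foded (q : ℂ) : ℂ := ∑' n : ℕ, odedTerm q n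

/-- The `n`-th term `q^{2n+1} (-q; q^2)_n (-q^{2n+2}; q^2)_∞` of `F^{ed}_{od}(q)`. -/
def edodTerm (q : ℂ) (n : ℕ) : ℂ :=
  q ^ (2 * n + 1) * qPoch (-q) (q ^ 2) n * qPochInf (-q ^ (2 * n + 2)) (q ^ 2)

/-- `F^{ed}_{od}(q)`: generating function of the partitions into distinct parts, at least one of
them odd, in which every odd part is smaller than every even part (`2n+1` is the largest odd
part). -/
def Fedod (q : ℂ) : ℂ := ∑' n : ℕ, edodTerm q n

/-- The `n`-th term `q^{2n+1} (-q^{2n+2}; q^2)_∞ / (q; q^2)_{n+1}` of `F^{ed}_{ou}(q)`. -/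
def edouTerm (q : ℂ) (n : ℕ) : ℂ :=
  q ^ (2 * n + 1) * qPochInf (-q ^ (2 * n + 2)) (q ^ 2) / qPoch q (q ^ 2) (n + 1)

/-- `F^{ed}_{ou}(q)`: generating function of the partitions with at least one odd part, in which
the even parts are distinct, odd parts may be repeated, and every odd part is smaller than every
even part (`2n+1` is the largest odd part). -/
def Fedou (q : ℂ) : ℂ := ∑' n : ℕ, edouTerm q n

/-- The `n`-th term (`n ∈ ℤ`) `(-1)^n q^{3n(n+1)/2} / (1 + q^n)` of the bilateral sum; the
integer division is exact, since `n(n+1)` is even. -/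
def appellTerm (q : ℂ) (n : ℤ) : ℂ :=
  (-1) ^ n * q ^ (3 * n * (n + 1) / 2) / (1 + q ^ n)

end

open Filter Topology

/-! Identities (1) and (2) telescope. Multiplied by `q - 1`, each summand is `q` times the
difference of consecutive values of a finite product over one parity times an infinite product over
the other; the right-hand side compares the limit of these values with the initial one.

For (3), replacing `q` by `-q` merges the two products over `q ^ 2` into one over `q`, so that up to
the factor `-(-q^2;q^2)_∞` the series is the odd-index part of `∑ q^n / (-q;q)_n`. That part is half
the difference of this sum and `∑ (-q)^n / (-q;q)_n`. The former telescopes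
(`hasSum_pow_div_qPoch_succ`). The latter becomes `∑ q^(n(n+1)) / ((-q;q)_n (-q;q)_{n+1})` by
`hasSum_rogersFine`.

This last series is handled by a Bailey-type argument. Each summand is expanded in partial fractions
(`two_mul_sum_partialFractions`), and the order of summation is exchanged. The inner sums are all
equal to `1 / (q;q)_∞` by Cauchy's identity (`hasSum_cauchy_pow`), and the outer sum is the
bilateral series with the indices `r` and `-(r + 1)` paired. -/

theorem one_sub_ne_zero_of_norm_lt_one {z : ℂ} (hz : ‖z‖ < 1) : 1 - z ≠ 0 := by
  intro h
  rw [← sub_eq_zero.mp h] at hz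
  simp at hz

theorem one_add_ne_zero_of_norm_lt_one {z : ℂ} (hz : ‖z‖ < 1) : 1 + z ≠ 0 := by
  have := one_sub_ne_zero_of_norm_lt_one (z := -z) (by simpa using hz)
  simpa using this

theorem norm_mul_pow_lt_one {a q : ℂ} (ha : ‖a‖ < 1) (hq : ‖q‖ < 1) (n : ℕ) :
    ‖a * q ^ n‖ < 1 := by
  rw [norm_mul, norm_pow]
  exact mul_lt_one_of_nonneg_of_lt_one_left (norm_nonneg _) ha
    (pow_le_one₀ (norm_nonneg _) hq.le)

theorem norm_pow_succ_lt_one {q : ℂ} (hq : ‖q‖ < 1) (n : ℕ) : ‖q ^ (n + 1)‖ < 1 := by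
  rw [pow_succ']
  exact norm_mul_pow_lt_one hq hq n

/-! ### Finite and infinite q-Pochhammer symbols, and summation tools -/

@[simp] theorem qPoch_zero (a q : ℂ) : qPoch a q 0 = 1 := by simp [qPoch]

theorem qPoch_succ (a q : ℂ) (n : ℕ) :
    qPoch a q (n + 1) = qPoch a q n * (1 - a * q ^ n) := by
  simp [qPoch, Finset.prod_range_succ]

theorem qPoch_add (a q : ℂ) (m n : ℕ) :
    qPoch a q (m + n) = qPoch a q m * qPoch (a * q ^ m) q n := by
  simp [qPoch, Finset.prod_range_add, pow_add, mul_assoc]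

theorem qPoch_succ' (a q : ℂ) (n : ℕ) :
    qPoch a q (n + 1) = (1 - a) * qPoch (a * q) q n := by
  rw [add_comm n 1, qPoch_add]
  simp [qPoch]

theorem qPoch_ne_zero {a q : ℂ} (ha : ‖a‖ < 1) (hq : ‖q‖ < 1) (n : ℕ) : qPoch a q n ≠ 0 :=
  Finset.prod_ne_zero_iff.mpr fun j _ =>
    one_sub_ne_zero_of_norm_lt_one (norm_mul_pow_lt_one ha hq j)

theorem qPochInf_ne_zero {a q : ℂ} (ha : ‖a‖ < 1) (hq : ‖q‖ < 1) : qPochInf a q ≠ 0 := by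
  have h : Summable fun j : ℕ => ‖-(a * q ^ j)‖ := by
    simp only [norm_neg, norm_mul, norm_pow]
    exact (summable_geometric_of_lt_one (norm_nonneg q) hq).mul_left _
  have := tprod_one_add_ne_zero_of_summable (f := fun j : ℕ => -(a * q ^ j)) (fun j => by
    simpa [sub_eq_add_neg] using one_sub_ne_zero_of_norm_lt_one (norm_mul_pow_lt_one ha hq j)) h
  simpa [qPochInf, sub_eq_add_neg] using this

theorem tendsto_qPoch (a : ℂ) {q : ℂ} (hq : ‖q‖ < 1) :
    Tendsto (qPoch a q) atTop (𝓝 (qPochInf a q)) :=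
  (multipliable_qPochInf a q hq).hasProd.tendsto_prod_nat

theorem qPochInf_eq_qPoch_mul (a : ℂ) {q : ℂ} (hq : ‖q‖ < 1) (n : ℕ) :
    qPochInf a q = qPoch a q n * qPochInf (a * q ^ n) q := by
  have h := tendsto_qPoch a hq
  have h1 := (tendsto_add_atTop_iff_nat n).mpr h
  have h2 := (tendsto_qPoch (a * q ^ n) hq).const_mul (qPoch a q n)
  refine tendsto_nhds_unique h1 (h2.congr fun m => ?_)
  rw [add_comm, qPoch_add]

theorem tendsto_qPochInf_mul_pow {a q : ℂ} (ha : ‖a‖ < 1) (hq : ‖q‖ < 1) :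
    Tendsto (fun n => qPochInf (a * q ^ n) q) atTop (𝓝 1) := by
  have h := (tendsto_qPoch a hq).inv₀ (qPochInf_ne_zero ha hq)
  have h2 := h.const_mul (qPochInf a q)
  rw [mul_inv_cancel₀ (qPochInf_ne_zero ha hq)] at h2
  refine h2.congr fun n => ?_
  rw [qPochInf_eq_qPoch_mul a hq n, mul_right_comm, mul_inv_cancel₀ (qPoch_ne_zero ha hq n),
    one_mul]

theorem exists_norm_le_of_tendsto {u : ℕ → ℂ} {l : ℂ} (hu : Tendsto u atTop (𝓝 l)) :
    ∃ C, 0 ≤ C ∧ ∀ n, ‖u n‖ ≤ C := by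
  obtain ⟨C, hC⟩ := (Metric.isBounded_range_of_tendsto u hu).exists_norm_le
  exact ⟨C, (norm_nonneg _).trans (hC (u 0) ⟨0, rfl⟩), fun n => hC _ ⟨n, rfl⟩⟩

theorem exists_norm_inv_qPoch_le {a q : ℂ} (ha : ‖a‖ < 1) (hq : ‖q‖ < 1) :
    ∃ C, 0 ≤ C ∧ ∀ n, ‖(qPoch a q n)⁻¹‖ ≤ C :=
  exists_norm_le_of_tendsto ((tendsto_qPoch a hq).inv₀ (qPochInf_ne_zero ha hq))

theorem summable_of_norm_le_mul_pow {f : ℕ → ℂ} {C r : ℝ} (h0 : 0 ≤ r) (h1 : r < 1)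
    (h : ∀ n, ‖f n‖ ≤ C * r ^ n) : Summable f :=
  Summable.of_norm_bounded ((summable_geometric_of_lt_one h0 h1).mul_left C) h

theorem hasSum_of_eq {f g : ℕ → ℂ} {l : ℂ} (hf : HasSum f l) (h : ∀ n, g n = f n) :
    HasSum g l := by
  rwa [funext h]

theorem norm_pow_le_norm_pow {q : ℂ} (hq : ‖q‖ < 1) {m n : ℕ} (h : m ≤ n) :
    ‖q ^ n‖ ≤ ‖q‖ ^ m := by
  rw [norm_pow]
  exact pow_le_pow_of_le_one (norm_nonneg _) hq.le h

theorem summable_pow_mul_of_tendsto {q l : ℂ} (hq : ‖q‖ < 1) {u : ℕ → ℂ}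
    (hu : Tendsto u atTop (𝓝 l)) {e : ℕ → ℕ} (he : ∀ n, n ≤ e n) :
    Summable fun n => q ^ e n * u n := by
  obtain ⟨C, hC, h⟩ := exists_norm_le_of_tendsto hu
  refine summable_of_norm_le_mul_pow (C := C) (norm_nonneg q) hq fun n => ?_
  rw [norm_mul, mul_comm]
  exact mul_le_mul (h n) (norm_pow_le_norm_pow hq (he n)) (norm_nonneg _) hC

theorem hasSum_of_telescoping {f T : ℕ → ℂ} {l : ℂ} (hf : Summable f)
    (hT : ∀ n, f n = T (n + 1) - T n) (hl : Tendsto T atTop (𝓝 l)) :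
    HasSum f (l - T 0) := by
  rw [hf.hasSum_iff_tendsto_nat]
  refine (hl.sub_const (T 0)).congr fun n => ?_
  rw [← Finset.sum_range_sub]
  exact Finset.sum_congr rfl fun i _ => (hT i).symm

theorem norm_sq_lt_one {q : ℂ} (hq : ‖q‖ < 1) : ‖q ^ 2‖ < 1 := norm_pow_succ_lt_one hq 1

theorem norm_neg_sq_lt_one {q : ℂ} (hq : ‖q‖ < 1) : ‖-q ^ 2‖ < 1 := by
  rw [norm_neg]
  exact norm_sq_lt_one hq

theorem norm_neg_lt_one {q : ℂ} (hq : ‖q‖ < 1) : ‖-q‖ < 1 := by rwa [norm_neg]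

theorem qPochInf_step (a : ℂ) {q : ℂ} (hq : ‖q‖ < 1) :
    qPochInf a q = (1 - a) * qPochInf (a * q) q := by
  simpa [qPoch] using qPochInf_eq_qPoch_mul a hq 1

/-! ### Identities (1) and (2) by telescoping -/

theorem summable_odedTerm {q : ℂ} (hq : ‖q‖ < 1) : Summable (odedTerm q) := by
  have h := ((tendsto_qPoch (-q ^ 2) (norm_sq_lt_one hq)).mul
    ((tendsto_add_atTop_iff_nat 1).mpr
      (tendsto_qPochInf_mul_pow (norm_neg_lt_one hq) (norm_sq_lt_one hq))))
  refine (summable_pow_mul_of_tendsto hq h (e := fun n => 2 * n + 2) fun n => by omega).congr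
    fun n => ?_
  rw [odedTerm, mul_assoc, show -q * (q ^ 2) ^ (n + 1) = -q ^ (2 * n + 3) by ring]

theorem summable_edodTerm {q : ℂ} (hq : ‖q‖ < 1) : Summable (edodTerm q) := by
  have h := ((tendsto_qPoch (-q) (norm_sq_lt_one hq)).mul
    (tendsto_qPochInf_mul_pow (norm_neg_sq_lt_one hq) (norm_sq_lt_one hq)))
  refine (summable_pow_mul_of_tendsto hq h (e := fun n => 2 * n + 1) fun n => by omega).congr
    fun n => ?_
  rw [edodTerm, mul_assoc, show -q ^ 2 * (q ^ 2) ^ n = -q ^ (2 * n + 2) by ring]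

theorem Foded_eq {q : ℂ} (hq : ‖q‖ < 1) :
    Foded q = q * qPochInf (-q) (q ^ 2) / (1 - q) *
        (1 - qPochInf (-q ^ 2) (q ^ 2) / qPochInf (-q) (q ^ 2)) := by
  have hq2 := norm_sq_lt_one hq
  have hA := qPochInf_ne_zero (norm_neg_lt_one hq) hq2
  have h1q := one_sub_ne_zero_of_norm_lt_one hq
  set T : ℕ → ℂ := fun n => qPoch (-q ^ 2) (q ^ 2) n * qPochInf (-q * (q ^ 2) ^ n) (q ^ 2) with hT
  have hl : Tendsto T atTop (𝓝 (qPochInf (-q ^ 2) (q ^ 2))) := by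
    simpa only [mul_one] using (tendsto_qPoch (-q ^ 2) hq2).mul
      (tendsto_qPochInf_mul_pow (norm_neg_lt_one hq) hq2)
  have h := hasSum_of_telescoping (f := fun n => (q - 1) * odedTerm q n) (T := fun n => q * T n)
    ((summable_odedTerm hq).mul_left _) (fun n => by
      simp only [hT]
      rw [qPochInf_step (-q * (q ^ 2) ^ n) hq2, qPoch_succ, odedTerm,
        show -q * (q ^ 2) ^ (n + 1) = -q ^ (2 * n + 3) by ring,
        show -q * (q ^ 2) ^ n * q ^ 2 = -q ^ (2 * n + 3) by ring]
      ring) (hl.const_mul q)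
  have h2 := h.tsum_eq
  rw [tsum_mul_left] at h2
  change (q - 1) * Foded q = _ at h2
  simp only [hT, qPoch_zero, pow_zero, mul_one, one_mul] at h2
  field_simp
  linear_combination -h2

theorem Fedod_eq {q : ℂ} (hq : ‖q‖ < 1) :
    Fedod q = q * qPochInf (-q ^ 2) (q ^ 2) / (1 - q) *
        (2 - qPochInf (-q) (q ^ 2) / qPochInf (-q ^ 2) (q ^ 2)) := by
  have hq2 := norm_sq_lt_one hq
  have hB := qPochInf_ne_zero (norm_neg_sq_lt_one hq) hq2
  have h1q := one_sub_ne_zero_of_norm_lt_one hq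
  set T : ℕ → ℂ := fun n => qPoch (-q) (q ^ 2) n * qPochInf (-1 * (q ^ 2) ^ n) (q ^ 2) with hT
  -- The base `-1` is not inside the unit disc, so the limit is taken after a shift by one, where
  -- the base becomes `-q ^ 2`.
  have hl : Tendsto T atTop (𝓝 (qPochInf (-q) (q ^ 2))) := by
    rw [← tendsto_add_atTop_iff_nat 1]
    have h1 := ((tendsto_add_atTop_iff_nat 1).mpr (tendsto_qPoch (-q) hq2)).mul
      (tendsto_qPochInf_mul_pow (norm_neg_sq_lt_one hq) hq2)
    rw [mul_one] at h1
    refine h1.congr fun n => ?_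
    simp only [hT]
    rw [show -1 * (q ^ 2) ^ (n + 1) = -q ^ 2 * (q ^ 2) ^ n by ring]
  have h := hasSum_of_telescoping (f := fun n => (q - 1) * edodTerm q n) (T := fun n => q * T n)
    ((summable_edodTerm hq).mul_left _) (fun n => by
      simp only [hT]
      rw [qPochInf_step (-1 * (q ^ 2) ^ n) hq2, qPoch_succ, edodTerm,
        show -1 * (q ^ 2) ^ (n + 1) = -q ^ (2 * n + 2) by ring,
        show -1 * (q ^ 2) ^ n * q ^ 2 = -q ^ (2 * n + 2) by ring]
      ring) (hl.const_mul q)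
  have h2 := h.tsum_eq
  rw [tsum_mul_left] at h2
  change (q - 1) * Fedod q = _ at h2
  simp only [hT, qPoch_zero, pow_zero, mul_one, one_mul] at h2
  -- The factor `1 - (-1)` split off here is the 2 in the identity.
  rw [qPochInf_step (-1) hq2, show (-1 : ℂ) * q ^ 2 = -q ^ 2 by ring] at h2
  field_simp
  linear_combination -h2

/-! ### The Rogers–Fine and Cauchy identities -/

theorem summable_pow_div_qPoch {a t q : ℂ} (ha : ‖a‖ < 1) (ht : ‖t‖ < 1) (hq : ‖q‖ < 1)
    (N : ℕ) : Summable fun n => t ^ n / qPoch a q (N + n) := by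
  obtain ⟨C, hC, h⟩ := exists_norm_inv_qPoch_le ha hq
  refine summable_of_norm_le_mul_pow (C := C) (norm_nonneg t) ht fun n => ?_
  rw [div_eq_mul_inv, norm_mul, mul_comm, norm_pow]
  exact mul_le_mul_of_nonneg_right (h _) (by positivity)

/-- With `s = t q^N`, subtract `s` times the series from its shift: `1/(a;q)_{N+n+1} - 1/(a;q)_{N+n}
= a q^(N+n) / (a;q)_{N+n+1}`, and the extra `q^n` turns `s` into `s q`. -/
theorem rogersFine_step {a t q : ℂ} (ha : ‖a‖ < 1) (ht : ‖t‖ < 1) (hq : ‖q‖ < 1) (N : ℕ) :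
    (1 - t * q ^ N) * ∑' n, (t * q ^ N) ^ n / qPoch a q (N + n) =
      (qPoch a q N)⁻¹ + t * a * q ^ (2 * N) *
        ∑' n, (t * q ^ (N + 1)) ^ n / qPoch a q (N + 1 + n) := by
  have hs := norm_mul_pow_lt_one ht hq N
  have h0 := summable_pow_div_qPoch ha hs hq N
  have h1 := (summable_nat_add_iff 1).mpr h0
  rw [sub_mul, one_mul, ← tsum_mul_left]
  nth_rewrite 1 [h0.tsum_eq_zero_add]
  rw [add_sub_assoc, ← h1.tsum_sub (h0.mul_left _), ← tsum_mul_left]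
  congr 1
  · simp
  refine tsum_congr fun n => ?_
  have e : N + (n + 1) = N + n + 1 := by ring
  have e' : N + 1 + n = N + n + 1 := by ring
  have hne := qPoch_ne_zero ha hq (N + n)
  have hne' := one_sub_ne_zero_of_norm_lt_one (norm_mul_pow_lt_one ha hq (N + n))
  rw [e, e', qPoch_succ]
  field_simp
  ring

theorem norm_pow_mul_pow_mul_pow_le {a t q : ℂ} (ha : ‖a‖ < 1) (hq : ‖q‖ < 1) (n e : ℕ) :
    ‖a ^ n * t ^ n * q ^ e‖ ≤ ‖t‖ ^ n := by
  rw [norm_mul, norm_mul, norm_pow, norm_pow, norm_pow, mul_right_comm]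
  exact mul_le_of_le_one_left (by positivity)
    (mul_le_one₀ (pow_le_one₀ (norm_nonneg _) ha.le) (by positivity)
      (pow_le_one₀ (norm_nonneg _) hq.le))

/-- The case `a = 0` of the Rogers–Fine identity. -/
theorem hasSum_rogersFine {a t q : ℂ} (ha : ‖a‖ < 1) (ht : ‖t‖ < 1) (hq : ‖q‖ < 1) :
    HasSum (fun n => a ^ n * t ^ n * q ^ (n * (n - 1)) / (qPoch a q n * qPoch t q (n + 1)))
      (∑' n, t ^ n / qPoch a q n) := by
  obtain ⟨C, hC, hCa⟩ := exists_norm_inv_qPoch_le ha hq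
  obtain ⟨K, hK, hKt⟩ := exists_norm_inv_qPoch_le ht hq
  set c : ℕ → ℂ := fun n =>
    a ^ n * t ^ n * q ^ (n * (n - 1)) / (qPoch a q n * qPoch t q (n + 1)) with hc
  set R : ℕ → ℂ := fun N => ∑' n, (t * q ^ N) ^ n / qPoch a q (N + n) with hR
  have hcs : Summable c := by
    refine summable_of_norm_le_mul_pow (C := K * C) (norm_nonneg t) ht fun n => ?_
    simp only [hc, div_eq_mul_inv, mul_inv_rev]
    rw [norm_mul, mul_comm, norm_mul]
    exact mul_le_mul (mul_le_mul (hKt _) (hCa _) (norm_nonneg _) hK)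
      (norm_pow_mul_pow_mul_pow_le ha hq _ _) (norm_nonneg _) (by positivity)
  have hRb : ∀ N, ‖R N‖ ≤ C * (1 - ‖t‖)⁻¹ := by
    intro N
    rw [← tsum_geometric_of_lt_one (norm_nonneg t) ht, ← tsum_mul_left]
    refine tsum_of_norm_bounded
      ((summable_geometric_of_lt_one (norm_nonneg t) ht).mul_left C).hasSum fun n => ?_
    rw [div_eq_mul_inv, norm_mul, mul_comm]
    refine mul_le_mul (hCa _) ?_ (norm_nonneg _) hC
    rw [norm_pow, norm_mul]
    exact pow_le_pow_left₀ (by positivity)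
      (mul_le_of_le_one_right (norm_nonneg _)
        (by rw [norm_pow]; exact pow_le_one₀ (norm_nonneg _) hq.le)) _
  -- `N` iterations of `rogersFine_step`; the exponents `2 * i` for `i < N` add up to `N * (N - 1)`.
  -- As `R` is bounded, the remainder is `O(‖t‖ ^ N)`.
  have key : ∀ N, ∑' n, t ^ n / qPoch a q n = ∑ n ∈ Finset.range N, c n +
      a ^ N * t ^ N * q ^ (N * (N - 1)) * (qPoch t q N)⁻¹ * R N := by
    intro N
    induction N with
    | zero => simp [hR]
    | succ N ih =>
      rw [ih, Finset.sum_range_succ, add_assoc]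
      congr 1
      have hstep : (1 - t * q ^ N) * R N =
        (qPoch a q N)⁻¹ + t * a * q ^ (2 * N) * R (N + 1) := rogersFine_step ha ht hq N
      have h1 := one_sub_ne_zero_of_norm_lt_one (norm_mul_pow_lt_one ht hq N)
      have h2 := qPoch_ne_zero ha hq N
      have h3 := qPoch_ne_zero ht hq N
      have hR' : R N = ((qPoch a q N)⁻¹ + t * a * q ^ (2 * N) * R (N + 1)) / (1 - t * q ^ N) := by
        rw [← hstep]; field_simp
      have e : (N + 1) * (N + 1 - 1) = N * (N - 1) + 2 * N := by
        cases N with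
        | zero => rfl
        | succ k => simp; ring
      rw [hR', e, pow_add q, hc]
      simp only [qPoch_succ]
      field_simp
      ring
  rw [hcs.hasSum_iff_tendsto_nat]
  have hz : Tendsto (fun N => a ^ N * t ^ N * q ^ (N * (N - 1)) * (qPoch t q N)⁻¹ * R N)
      atTop (𝓝 0) := by
    refine squeeze_zero_norm (a := fun N => ‖t‖ ^ N * (K * (C * (1 - ‖t‖)⁻¹))) (fun N => ?_) ?_
    · rw [mul_assoc, norm_mul, norm_mul (_)⁻¹]
      exact mul_le_mul (norm_pow_mul_pow_mul_pow_le ha hq _ _)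
        (mul_le_mul (hKt _) (hRb _) (norm_nonneg _) hK) (by positivity) (by positivity)
    · simpa using (tendsto_pow_atTop_nhds_zero_of_lt_one (norm_nonneg t) ht).mul_const
        (K * (C * (1 - ‖t‖)⁻¹))
  have := hz.const_sub (∑' n, t ^ n / qPoch a q n)
  rw [sub_zero] at this
  refine this.congr fun N => ?_
  rw [key N]
  ring

theorem hasSum_pow_div_qPoch_succ {a q : ℂ} (ha : ‖a‖ < 1) (hq : ‖q‖ < 1) :
    HasSum (fun n => a * q ^ n / qPoch a q (n + 1)) ((qPochInf a q)⁻¹ - 1) := by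
  have hs : Summable fun n => a * q ^ n / qPoch a q (n + 1) := by
    simpa [mul_div_assoc, add_comm] using (summable_pow_div_qPoch ha hq hq 1).mul_left a
  have := hasSum_of_telescoping hs (T := fun n => (qPoch a q n)⁻¹) (fun n => by
    have h1 := one_sub_ne_zero_of_norm_lt_one (norm_mul_pow_lt_one ha hq n)
    have h2 := qPoch_ne_zero ha hq n
    rw [qPoch_succ]
    field_simp
    ring) ((tendsto_qPoch a hq).inv₀ (qPochInf_ne_zero ha hq))
  simpa using this

/-- Cauchy's identity, the Durfee rectangle dissection of `1 / (a; q)_∞`. -/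
theorem hasSum_cauchy {a q : ℂ} (ha : ‖a‖ < 1) (hq : ‖q‖ < 1) :
    HasSum (fun m => a ^ m * q ^ (m * (m - 1)) / (qPoch a q m * qPoch q q m))
      (qPochInf a q)⁻¹ := by
  have haq : ‖a * q‖ < 1 := by simpa using norm_mul_pow_lt_one ha hq 1
  have h1a := one_sub_ne_zero_of_norm_lt_one ha
  -- Rogers–Fine with `a q` for `a` and `t = q`: its term `m` becomes term `m + 1` of Cauchy's
  -- series, and its left side telescopes.
  have h := (hasSum_rogersFine haq hq hq).mul_left (a / (1 - a))
  have h0 := (hasSum_pow_div_qPoch_succ ha hq).tsum_eq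
  have h2 : a / (1 - a) * ∑' n, q ^ n / qPoch (a * q) q n = (qPochInf a q)⁻¹ - 1 := by
    rw [← h0, ← tsum_mul_left]
    refine tsum_congr fun n => ?_
    rw [qPoch_succ', div_mul_div_comm]
  rw [h2] at h
  rw [← hasSum_nat_add_iff' 1]
  simp only [Finset.sum_range_one, pow_zero, qPoch_zero, zero_mul, mul_one, div_one]
  refine hasSum_of_eq h fun m => ?_
  have e : (m + 1) * (m + 1 - 1) = m * (m - 1) + 2 * m := by
    cases m with
    | zero => rfl
    | succ k => simp; ring
  rw [e, qPoch_succ' a, div_mul_div_comm]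
  congr 1
  · ring
  · ring

/-- Cauchy's identity at `a = q^(k+1)`, divided by `(q;q)_k`; the value does not depend on `k`. -/
theorem hasSum_cauchy_pow {q : ℂ} (hq : ‖q‖ < 1) (k : ℕ) :
    HasSum (fun m => q ^ (m * (m + k)) / (qPoch q q m * qPoch q q (m + k)))
      (qPochInf q q)⁻¹ := by
  have h := (hasSum_cauchy (norm_pow_succ_lt_one hq k) hq).mul_left (qPoch q q k)⁻¹
  rw [← mul_inv, pow_succ', ← qPochInf_eq_qPoch_mul q hq k] at h
  refine hasSum_of_eq h fun m => ?_
  have e : q ^ (m * (m + k)) = (q * q ^ k) ^ m * q ^ (m * (m - 1)) := by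
    rw [← pow_succ', ← pow_mul, ← pow_add]
    congr 1
    cases m with
    | zero => simp
    | succ m => simp; ring
  rw [e, add_comm m k, qPoch_add, div_eq_mul_inv, div_eq_mul_inv]
  simp only [mul_inv_rev]
  ring

/-! ### The q-binomial theorem and partial fractions -/

/-- The finite `q`-binomial theorem. -/
theorem sum_qBinomial {q : ℂ} (hq : ‖q‖ < 1) (z : ℂ) (N : ℕ) :
    ∑ k ∈ Finset.range (N + 1),
      (-z) ^ k * q ^ k.choose 2 / (qPoch q q k * qPoch q q (N - k)) =
        qPoch z q N / qPoch q q N := by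
  induction N with
  | zero => simp
  | succ N ih =>
    have hp := qPoch_ne_zero hq hq
    have h1 : ∀ n, 1 - q * q ^ n ≠ 0 := fun n =>
      one_sub_ne_zero_of_norm_lt_one (norm_mul_pow_lt_one hq hq n)
    set F : ℕ → ℂ := fun k =>
      (-z) ^ k * q ^ k.choose 2 / (qPoch q q k * qPoch q q (N + 1 - k)) with hF
    set G : ℕ → ℂ := fun k =>
      (-z) ^ k * q ^ k.choose 2 / (qPoch q q k * qPoch q q (N - k)) with hG
    -- The sums `hA` and `hB` come from the splitting `1 - q^(N+1) = (1 - q^(N+1-k)) + q^(N+1-k) (1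
    -- - q^k)`; each factor cancels against one Pochhammer symbol.
    have hA : ∑ k ∈ Finset.range (N + 2), (1 - q ^ (N + 1 - k)) * F k =
        ∑ k ∈ Finset.range (N + 1), G k := by
      rw [Finset.sum_range_succ]
      simp only [Nat.sub_self, pow_zero, sub_self, zero_mul, add_zero]
      refine Finset.sum_congr rfl fun k hk => ?_
      obtain ⟨j, rfl⟩ := Nat.exists_eq_add_of_le (Nat.lt_succ_iff.mp (Finset.mem_range.mp hk))
      have e : k + j + 1 - k = j + 1 := by omega
      have e' : k + j - k = j := by omega
      simp only [hF, hG, e, e', qPoch_succ]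
      have := hp k
      have := hp j
      have := h1 j
      field_simp
      ring
    have hB : ∑ k ∈ Finset.range (N + 2), q ^ (N + 1 - k) * (1 - q ^ k) * F k =
        -z * q ^ N * ∑ k ∈ Finset.range (N + 1), G k := by
      rw [Finset.sum_range_succ', Finset.mul_sum]
      simp only [pow_zero, sub_self, zero_mul, mul_zero, add_zero]
      refine Finset.sum_congr rfl fun k hk => ?_
      obtain ⟨j, rfl⟩ := Nat.exists_eq_add_of_le (Nat.lt_succ_iff.mp (Finset.mem_range.mp hk))
      have e : k + j + 1 - (k + 1) = j := by omega
      have e' : k + j - k = j := by omega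
      simp only [hF, hG, e, e', qPoch_succ, Nat.choose_succ_succ' k 1, Nat.choose_one_right]
      have := hp k
      have := hp j
      have := h1 k
      field_simp
      ring
    have hAB : (1 - q * q ^ N) * ∑ k ∈ Finset.range (N + 2), F k =
        (1 - z * q ^ N) * ∑ k ∈ Finset.range (N + 1), G k := by
      have e0 : (1 - z * q ^ N) * ∑ k ∈ Finset.range (N + 1), G k =
          ∑ k ∈ Finset.range (N + 1), G k +
            -z * q ^ N * ∑ k ∈ Finset.range (N + 1), G k := by ring
      rw [e0, ← hB, ← hA, ← Finset.sum_add_distrib, Finset.mul_sum]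
      refine Finset.sum_congr rfl fun k hk => ?_
      obtain ⟨j, hj⟩ := Nat.exists_eq_add_of_le (Nat.lt_succ_iff.mp (Finset.mem_range.mp hk))
      have e : N + 1 - k = j := by omega
      have e' : q * q ^ N = q ^ k * q ^ j := by rw [← pow_succ', hj, pow_add]
      rw [e, e']
      ring
    rw [ih] at hAB
    have := hp N
    have := h1 N
    rw [qPoch_succ, qPoch_succ]
    field_simp at hAB ⊢
    linear_combination hAB

/-- The q-binomial theorem of order `2n + 1` at `z = q^(-(n+1))`, where the product vanishes; the
indices `n - r` and `n + 1 + r` are paired. -/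
theorem sum_alternating_eq_zero {q : ℂ} (hq : ‖q‖ < 1) (hq0 : q ≠ 0) {n : ℕ} (hn : 1 ≤ n) :
    ∑ r ∈ Finset.range (n + 1), (-1) ^ r * q ^ r.choose 2 * (1 - q ^ (2 * r + 1)) /
      (qPoch q q (n - r) * qPoch q q (n + 1 + r)) = 0 := by
  have h := sum_qBinomial hq ((q⁻¹) ^ (n + 1)) (n + (n + 1))
  have hz : qPoch ((q⁻¹) ^ (n + 1)) q (n + (n + 1)) = 0 := by
    -- The vanishing factor has index `n + 1 < 2n + 1`, which requires `1 ≤ n`; for `n = 0` the sum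
    -- is 1.
    refine Finset.prod_eq_zero (i := n + 1) (Finset.mem_range.mpr (by omega)) ?_
    rw [← mul_pow, inv_mul_cancel₀ hq0, one_pow, sub_self]
  rw [hz, zero_div, show n + (n + 1) + 1 = (n + 1) + (n + 1) by ring, Finset.sum_range_add,
    ← Finset.sum_range_reflect, ← Finset.sum_add_distrib] at h
  -- This multiplier clears the negative powers of `q` and fixes the sign.
  have h2 := congrArg (fun x => (-1) ^ (n + 1) * q ^ (n + 2).choose 2 * x) h
  simp only [mul_zero, Finset.mul_sum] at h2
  rw [← h2]
  refine Finset.sum_congr rfl fun r hr => ?_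
  obtain ⟨j, rfl⟩ := Nat.exists_eq_add_of_le (Nat.lt_succ_iff.mp (Finset.mem_range.mp hr))
  have e1 : r + j + 1 - 1 - r = j := by omega
  have e2 : r + j - r = j := by omega
  have e3 : r + j + (r + j + 1) - j = r + j + 1 + r := by omega
  have e4 : r + j + (r + j + 1) - (r + j + 1 + r) = j := by omega
  have c1 : j.choose 2 + (r + j + 2).choose 2 = (r + j + 1) * j + (r.choose 2 + (2 * r + 1)) := by
    have : ((j.choose 2 + (r + j + 2).choose 2 : ℕ) : ℚ) =
        ((r + j + 1) * j + (r.choose 2 + (2 * r + 1)) : ℕ) := by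
      push_cast [Nat.cast_choose_two]
      ring
    exact_mod_cast this
  have c2 : (r + j + 1 + r).choose 2 + (r + j + 2).choose 2 =
      (r + j + 1) * (r + j + 1 + r) + r.choose 2 := by
    have : (((r + j + 1 + r).choose 2 + (r + j + 2).choose 2 : ℕ) : ℚ) =
        ((r + j + 1) * (r + j + 1 + r) + r.choose 2 : ℕ) := by
      push_cast [Nat.cast_choose_two]
      ring
    exact_mod_cast this
  have p : ∀ m x y : ℕ, x + (r + j + 2).choose 2 = (r + j + 1) * m + y →
      (-1) ^ (r + j + 1) * q ^ (r + j + 2).choose 2 * ((-(q⁻¹) ^ (r + j + 1)) ^ m * q ^ x) =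
        (-1) ^ (r + j + 1 + m) * q ^ y := by
    intro m x y hxy
    have : q ^ x * q ^ (r + j + 2).choose 2 = q ^ ((r + j + 1) * m) * q ^ y := by
      rw [← pow_add, hxy, pow_add]
    rw [neg_pow (q⁻¹ ^ (r + j + 1)) m, ← pow_mul, inv_pow, pow_add (-1 : ℂ) _ m]
    calc _ = (-1) ^ (r + j + 1) * (-1) ^ m * (q ^ ((r + j + 1) * m))⁻¹ *
          (q ^ x * q ^ (r + j + 2).choose 2) := by ring
      _ = _ := by
        rw [this]
        field_simp
  have s1 : (-1 : ℂ) ^ (r + j + 1 + j) = -(-1) ^ r := by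
    rw [show r + j + 1 + j = r + 1 + 2 * j by ring, pow_add _ _ (2 * j), pow_mul]
    simp [pow_succ]
  have s2 : (-1 : ℂ) ^ (r + j + 1 + (r + j + 1 + r)) = (-1) ^ r := by
    rw [show r + j + 1 + (r + j + 1 + r) = r + 2 * (r + j + 1) by ring, pow_add, pow_mul]
    simp
  rw [e1, e2, e3, e4, mul_add, mul_div_assoc', mul_div_assoc', p _ _ _ c1, p _ _ _ c2, s1, s2,
    pow_add q (r.choose 2)]
  have := qPoch_ne_zero hq hq j
  have := qPoch_ne_zero hq hq (r + j + 1 + r)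
  field_simp
  ring

theorem one_add_pow_ne_zero {q : ℂ} (hq : ‖q‖ < 1) (r : ℕ) : 1 + q ^ r ≠ 0 := by
  cases r with
  | zero => norm_num
  | succ r => exact one_add_ne_zero_of_norm_lt_one (norm_pow_succ_lt_one hq r)

/-- The partial fraction expansion of `1 / ((x; q)_{n+1} (q/x; q)_{n+1})` at `x = -1`, with the
poles `q^{-r}` and `q^{r+1}` taken together. -/
theorem two_mul_sum_partialFractions {q : ℂ} (hq : ‖q‖ < 1) (hq0 : q ≠ 0) (n : ℕ) :
    2 * ∑ r ∈ Finset.range (n + 1), (-1) ^ r * q ^ (r + 1).choose 2 * (1 - q ^ (2 * r + 1)) /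
      (qPoch q q (n - r) * qPoch q q (n + 1 + r) * ((1 + q ^ r) * (1 + q ^ (r + 1)))) =
        (qPoch (-q) q n * qPoch (-q) q (n + 1))⁻¹ := by
  have hp := qPoch_ne_zero hq hq
  have hm := qPoch_ne_zero (norm_neg_lt_one hq) hq
  have ho := one_add_pow_ne_zero hq
  have h1 : ∀ n, 1 - q * q ^ n ≠ 0 := fun n =>
    one_sub_ne_zero_of_norm_lt_one (norm_mul_pow_lt_one hq hq n)
  induction n with
  | zero =>
    have := one_sub_ne_zero_of_norm_lt_one hq
    have := one_add_ne_zero_of_norm_lt_one hq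
    simp [qPoch]
    field_simp
    norm_num
  | succ n ih =>
    have hz := sum_alternating_eq_zero hq hq0 (n := n + 1) (by omega)
    set f : ℕ → ℕ → ℂ := fun n r => (-1) ^ r * q ^ (r + 1).choose 2 * (1 - q ^ (2 * r + 1)) /
      (qPoch q q (n - r) * qPoch q q (n + 1 + r) * ((1 + q ^ r) * (1 + q ^ (r + 1)))) with hf
    set d : ℕ → ℂ := fun r => (-1) ^ r * q ^ r.choose 2 * (1 - q ^ (2 * r + 1)) /
      (qPoch q q (n + 1 - r) * qPoch q q (n + 1 + 1 + r)) with hd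
    -- Termwise, the factor `(1 + q^(n+1)) (1 + q^(n+2))` turns `f (n + 1) r` into `f n r + q^(n+1)
    -- * d r`, and the `d r` sum to zero. At `r = n + 1` the term `f n r` should be absent, but
    -- truncated subtraction does not make it zero, so this index is treated apart.
    have hlast : (1 + q ^ (n + 1)) * (1 + q ^ (n + 2)) * f (n + 1) (n + 1) =
        q ^ (n + 1) * d (n + 1) := by
      simp only [hf, hd, Nat.choose_succ_succ' (n + 1) 1, Nat.choose_one_right]
      have := hp (n + 1 - (n + 1))
      have := hp (n + 1 + 1 + (n + 1))
      have := ho (n + 1)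
      have := ho (n + 1 + 1)
      field_simp
      ring
    have hstep : (1 + q ^ (n + 1)) * (1 + q ^ (n + 2)) *
        ∑ r ∈ Finset.range (n + 1 + 1), f (n + 1) r = ∑ r ∈ Finset.range (n + 1), f n r := by
      have hmid : (1 + q ^ (n + 1)) * (1 + q ^ (n + 2)) *
          ∑ r ∈ Finset.range (n + 1), f (n + 1) r =
            ∑ r ∈ Finset.range (n + 1), f n r +
              q ^ (n + 1) * ∑ r ∈ Finset.range (n + 1), d r := by
        rw [Finset.mul_sum, Finset.mul_sum, ← Finset.sum_add_distrib]
        refine Finset.sum_congr rfl fun r hr => ?_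
        obtain ⟨j, rfl⟩ := Nat.exists_eq_add_of_le (Nat.lt_succ_iff.mp (Finset.mem_range.mp hr))
        have e1 : r + j + 1 - r = j + 1 := by omega
        have e2 : r + j - r = j := by omega
        have e3 : r + j + 1 + 1 + r = r + j + 1 + r + 1 := by omega
        simp only [hf, hd, e1, e2, e3, qPoch_succ q q j, qPoch_succ q q (r + j + 1 + r),
          Nat.choose_succ_succ' r 1, Nat.choose_one_right]
        have := hp j
        have := hp (r + j + 1 + r)
        have := h1 j
        have := h1 (r + j + 1 + r)
        have := ho r
        have := ho (r + 1)
        field_simp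
        ring
      rw [Finset.sum_range_succ] at hz ⊢
      linear_combination hmid + hlast + q ^ (n + 1) * hz
    have a1 := ho (n + 1)
    have a2 := ho (n + 2)
    have e1 : (1 : ℂ) - -q * q ^ n = 1 + q ^ (n + 1) := by ring
    have e2 : (1 : ℂ) - -q * q ^ (n + 1) = 1 + q ^ (n + 2) := by ring
    rw [← hstep, qPoch_succ, e1] at ih
    rw [qPoch_succ _ _ (n + 1), qPoch_succ, e1, e2]
    have := hm n
    change 2 * ∑ r ∈ Finset.range (n + 1 + 1), f (n + 1) r = _
    field_simp at ih ⊢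
    linear_combination ih

/-! ### The bilateral series and its one-sided form -/

/-- The sum of the terms of index `r` and `-(r + 1)` of the bilateral series `appellTerm q`. -/
noncomputable def appellPair (q : ℂ) (r : ℕ) : ℂ :=
  (-1) ^ r * q ^ (3 * (r + 1).choose 2) * (1 - q ^ (2 * r + 1)) /
    ((1 + q ^ r) * (1 + q ^ (r + 1)))

theorem exists_norm_inv_one_add_pow_le {q : ℂ} (hq : ‖q‖ < 1) :
    ∃ C, 0 ≤ C ∧ ∀ n : ℕ, ‖(1 + q ^ n)⁻¹‖ ≤ C := by
  have h := (tendsto_pow_atTop_nhds_zero_of_norm_lt_one hq).const_add 1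
  exact exists_norm_le_of_tendsto (h.inv₀ (by simp))

theorem le_three_mul_choose (r : ℕ) : r ≤ 3 * (r + 1).choose 2 := by
  rw [Nat.choose_succ_succ' r 1, Nat.choose_one_right]
  omega

theorem choose_two_mul_three (r : ℕ) :
    ((3 * (r + 1).choose 2 : ℕ) : ℤ) = 3 * (r : ℤ) * (r + 1) / 2 := by
  have h2 : (r + 1).choose 2 * 2 = (r + 1) * r := by
    rw [Nat.choose_two_right, Nat.div_mul_cancel]
    · simp
    · simpa [mul_comm] using (Nat.even_mul_succ_self r).two_dvd
  have h3 : (3 * (r : ℤ) * (r + 1)) = 2 * ((3 * (r + 1).choose 2 : ℕ) : ℤ) := by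
    have : (((r + 1).choose 2 : ℕ) : ℤ) * 2 = (r + 1) * r := by exact_mod_cast h2
    push_cast
    linear_combination -3 * this
  rw [h3]
  simp

theorem appellTerm_natCast (q : ℂ) (r : ℕ) :
    appellTerm q r = (-1) ^ r * q ^ (3 * (r + 1).choose 2) * (1 + q ^ r)⁻¹ := by
  rw [appellTerm, ← choose_two_mul_three, zpow_natCast, zpow_natCast, zpow_natCast, div_eq_mul_inv]

/-- The reflection `n ↦ -1 - n` preserves `n (n + 1)`; the fraction is then expanded by `q^(r+1)`.
-/
theorem appellTerm_neg_add_one {q : ℂ} (hq : ‖q‖ < 1) (hq0 : q ≠ 0) (r : ℕ) :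
    appellTerm q (-((r : ℤ) + 1)) =
      -((-1) ^ r * q ^ (3 * (r + 1).choose 2) * q ^ (r + 1) * (1 + q ^ (r + 1))⁻¹) := by
  have e : 3 * (-((r : ℤ) + 1)) * (-((r : ℤ) + 1) + 1) = 3 * (r : ℤ) * (r + 1) := by ring
  have e1 : (-1 : ℂ) ^ (-((r : ℤ) + 1)) = -(-1) ^ r := by
    rw [zpow_neg, ← inv_zpow, show ((-1 : ℂ))⁻¹ = -1 by norm_num]
    rw [zpow_add₀ (by norm_num), zpow_natCast, zpow_one]
    ring
  have e2 : q ^ (-((r : ℤ) + 1)) = (q ^ (r + 1))⁻¹ := by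
    rw [zpow_neg]
    norm_cast
  have := one_add_pow_ne_zero hq (r + 1)
  have h2 : 1 + (q ^ (r + 1))⁻¹ = (1 + q ^ (r + 1)) * (q ^ (r + 1))⁻¹ := by
    field_simp
    ring
  rw [appellTerm, e, ← choose_two_mul_three, zpow_natCast, e1, e2, h2]
  field_simp

theorem norm_neg_one_pow_mul (z : ℂ) (r : ℕ) : ‖(-1) ^ r * z‖ = ‖z‖ := by
  simp

theorem summable_appellTerm_and_tsum_eq {q : ℂ} (hq : ‖q‖ < 1) (hq0 : q ≠ 0) :
    Summable (appellTerm q) ∧ ∑' n : ℤ, appellTerm q n = ∑' r, appellPair q r := by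
  obtain ⟨C, hC, h⟩ := exists_norm_inv_one_add_pow_le hq
  have s1 : Summable fun r : ℕ => appellTerm q r := by
    refine summable_of_norm_le_mul_pow (C := C) (norm_nonneg q) hq fun r => ?_
    rw [appellTerm_natCast, mul_assoc, norm_neg_one_pow_mul, norm_mul, mul_comm]
    exact mul_le_mul (h r) (norm_pow_le_norm_pow hq (le_three_mul_choose r)) (norm_nonneg _) hC
  have s2 : Summable fun r : ℕ => appellTerm q (-((r : ℤ) + 1)) := by
    refine summable_of_norm_le_mul_pow (C := C) (norm_nonneg q) hq fun r => ?_
    rw [appellTerm_neg_add_one hq hq0, norm_neg, mul_assoc ((-1) ^ r), mul_assoc,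
      norm_neg_one_pow_mul, ← pow_add, norm_mul, mul_comm]
    exact mul_le_mul (h _) (norm_pow_le_norm_pow hq ((le_three_mul_choose r).trans
      (Nat.le_add_right _ _))) (norm_nonneg _) hC
  refine ⟨Summable.of_nat_of_neg_add_one s1 s2, ?_⟩
  rw [tsum_of_nat_of_neg_add_one s1 s2, ← s1.tsum_add s2]
  refine tsum_congr fun r => ?_
  have h1 := one_add_pow_ne_zero hq r
  have h2 := one_add_pow_ne_zero hq (r + 1)
  rw [appellTerm_natCast, appellTerm_neg_add_one hq hq0, appellPair]
  field_simp
  ring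

theorem exists_norm_appellPair_le {q : ℂ} (hq : ‖q‖ < 1) :
    ∃ C, 0 ≤ C ∧ ∀ r, ‖appellPair q r‖ ≤ C * ‖q‖ ^ r := by
  obtain ⟨C, hC, h⟩ := exists_norm_inv_one_add_pow_le hq
  refine ⟨2 * (C * C), by positivity, fun r => ?_⟩
  have h2 : ‖1 - q ^ (2 * r + 1)‖ ≤ 2 := by
    refine (norm_sub_le _ _).trans ?_
    have := (norm_pow_succ_lt_one hq (2 * r)).le
    rw [norm_one]
    linarith
  rw [appellPair, div_eq_mul_inv, mul_assoc ((-1) ^ r), mul_assoc, norm_neg_one_pow_mul, mul_assoc,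
    norm_mul, norm_mul, mul_inv, norm_mul, mul_comm]
  refine mul_le_mul (mul_le_mul h2 (mul_le_mul (h _) (h _) (norm_nonneg _) hC) (by positivity)
    (by norm_num)) (norm_pow_le_norm_pow hq (le_three_mul_choose r)) (norm_nonneg _) (by positivity)

/-- A double series over `(r, j)` with `n = r + j`: antidiagonals give the left side by partial
fractions, rows give the right side by Cauchy's identity with `k = 2r + 1`. -/
theorem tsum_mockTheta_eq_appell {q : ℂ} (hq : ‖q‖ < 1) (hq0 : q ≠ 0) :
    ∑' n, q ^ (n * (n + 1)) / (qPoch (-q) q n * qPoch (-q) q (n + 1)) =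
      2 / qPochInf q q * ∑' n : ℤ, appellTerm q n := by
  obtain ⟨K, hK, hKp⟩ := exists_norm_appellPair_le hq
  obtain ⟨C, hC, hCq⟩ := exists_norm_inv_qPoch_le hq hq
  set h : ℕ × ℕ → ℂ := fun p => appellPair q p.1 *
    (q ^ (p.2 * (p.2 + (2 * p.1 + 1))) / (qPoch q q p.2 * qPoch q q (p.2 + (2 * p.1 + 1)))) with hh
  have hgeo := summable_geometric_of_lt_one (norm_nonneg q) hq
  have hs : Summable h := by
    refine Summable.of_norm_bounded (g := fun p : ℕ × ℕ => (K * ‖q‖ ^ p.1) * (C * C * ‖q‖ ^ p.2))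
      ((hgeo.mul_left K).mul_of_nonneg (hgeo.mul_left (C * C)) (fun _ => by positivity)
        fun _ => by positivity) fun p => ?_
    rw [hh, norm_mul]
    refine mul_le_mul (hKp _) ?_ (norm_nonneg _) (by positivity)
    rw [div_eq_mul_inv, norm_mul, mul_inv, norm_mul, mul_comm]
    exact mul_le_mul (mul_le_mul (hCq _) (hCq _) (norm_nonneg _) hC)
      (norm_pow_le_norm_pow hq (Nat.le_mul_of_pos_right _ (by omega))) (norm_nonneg _)
      (by positivity)
  have hrow : ∑' p, h p = (qPochInf q q)⁻¹ * ∑' n : ℤ, appellTerm q n := by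
    rw [hs.tsum_prod, (summable_appellTerm_and_tsum_eq hq hq0).2, mul_comm, ← tsum_mul_right]
    refine tsum_congr fun r => ?_
    simp only [hh]
    rw [tsum_mul_left, (hasSum_cauchy_pow hq (2 * r + 1)).tsum_eq]
  have hdiag : HasSum (fun n => ∑ p ∈ Finset.HasAntidiagonal.antidiagonal n, h p) (∑' p, h p) := by
    have h1 := (Finset.HasAntidiagonal.sigmaAntidiagonalEquivProd.hasSum_iff).mpr hs.hasSum
    refine h1.sigma fun n => ?_
    exact Finset.hasSum (Finset.HasAntidiagonal.antidiagonal n) h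
  have hterm : ∀ n, q ^ (n * (n + 1)) / (qPoch (-q) q n * qPoch (-q) q (n + 1)) =
      2 * ∑ p ∈ Finset.HasAntidiagonal.antidiagonal n, h p := by
    intro n
    rw [div_eq_mul_inv, ← two_mul_sum_partialFractions hq hq0 n, mul_left_comm,
      Finset.Nat.sum_antidiagonal_eq_sum_range_succ_mk, Finset.mul_sum]
    congr 1
    refine Finset.sum_congr rfl fun r hr => ?_
    obtain ⟨j, rfl⟩ := Nat.exists_eq_add_of_le (Nat.lt_succ_iff.mp (Finset.mem_range.mp hr))
    have e1 : r + j - r = j := by omega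
    have e2 : j + (2 * r + 1) = r + j + 1 + r := by omega
    have e3 : q ^ ((r + j) * (r + j + 1)) * q ^ (r + 1).choose 2 =
        q ^ (3 * (r + 1).choose 2) * q ^ (j * (r + j + 1 + r)) := by
      rw [← pow_add, ← pow_add]
      congr 1
      have : (((r + j) * (r + j + 1) + (r + 1).choose 2 : ℕ) : ℚ) =
          (3 * (r + 1).choose 2 + j * (r + j + 1 + r) : ℕ) := by
        push_cast [Nat.cast_choose_two]
        ring
      exact_mod_cast this
    simp only [hh, appellPair, e1, e2]
    rw [mul_div_assoc', div_mul_div_comm]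
    congr 1
    · linear_combination (-1) ^ r * (1 - q ^ (2 * r + 1)) * e3
    · ring
  rw [tsum_congr hterm, tsum_mul_left, hdiag.tsum_eq, hrow]
  ring

/-! ### Identity (3) -/

theorem tsum_neg_pow_div_qPoch {q : ℂ} (hq : ‖q‖ < 1) (hq0 : q ≠ 0) :
    ∑' n, (-q) ^ n / qPoch (-q) q n = 2 / qPochInf q q * ∑' n : ℤ, appellTerm q n := by
  have hn := norm_neg_lt_one hq
  rw [← tsum_mockTheta_eq_appell hq hq0, ← (hasSum_rogersFine hn hn hq).tsum_eq]
  refine tsum_congr fun n => ?_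
  congr 1
  have e : n * (n + 1) = n * (n - 1) + 2 * n := by
    cases n with
    | zero => rfl
    | succ k => simp; ring
  rw [e, ← mul_pow, neg_mul_neg, pow_add]
  ring

/-- Odd and even powers of `q` interlace. -/
theorem qPoch_mul_qPoch_sq (q : ℂ) (n : ℕ) :
    qPoch (-q) (q ^ 2) (n + 1) * qPoch (-q ^ 2) (q ^ 2) n = qPoch (-q) q (2 * n + 1) := by
  induction n with
  | zero => simp [qPoch]
  | succ n ih =>
    rw [qPoch_succ _ _ (n + 1), qPoch_succ (-q ^ 2) (q ^ 2) n,
      show 2 * (n + 1) + 1 = 2 * n + 1 + 1 + 1 by ring,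
      qPoch_succ _ _ (2 * n + 1 + 1), qPoch_succ _ _ (2 * n + 1), ← ih]
    ring

theorem edouTerm_neg {q : ℂ} (hq : ‖q‖ < 1) (n : ℕ) :
    edouTerm (-q) n =
      -qPochInf (-q ^ 2) (q ^ 2) * (q ^ (2 * n + 1) / qPoch (-q) q (2 * n + 1)) := by
  have hq2 := norm_sq_lt_one hq
  have h1 := qPoch_ne_zero (norm_neg_lt_one hq) hq2 (n + 1)
  have h2 := qPoch_ne_zero (norm_neg_sq_lt_one hq) hq2 n
  rw [← qPoch_mul_qPoch_sq, qPochInf_eq_qPoch_mul (-q ^ 2) hq2 n, edouTerm, neg_sq,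
    show -(-q) ^ (2 * n + 2) = -q ^ 2 * (q ^ 2) ^ n by
      rw [show 2 * n + 2 = 2 * (n + 1) by ring, pow_mul]; ring,
    show (-q) ^ (2 * n + 1) = -q ^ (2 * n + 1) by rw [pow_succ, pow_mul]; ring]
  field_simp

theorem summable_edouTerm_neg {q : ℂ} (hq : ‖q‖ < 1) : Summable (edouTerm (-q)) := by
  have h := summable_pow_div_qPoch (norm_neg_lt_one hq) hq hq 0
  simp only [zero_add] at h
  refine ((h.comp_injective (i := fun n => 2 * n + 1) fun a b hab => by simpa using hab).mul_left
    (-qPochInf (-q ^ 2) (q ^ 2))).congr fun n => ?_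
  exact (edouTerm_neg hq n).symm

theorem tsum_odd_pow_div_qPoch {q : ℂ} (hq : ‖q‖ < 1) :
    2 * ∑' n, q ^ (2 * n + 1) / qPoch (-q) q (2 * n + 1) =
      2 - 1 / qPochInf (-q) q - ∑' n, (-q) ^ n / qPoch (-q) q n := by
  have hn := norm_neg_lt_one hq
  have s1 := summable_pow_div_qPoch hn hq hq 0
  have s2 := summable_pow_div_qPoch hn hn hq 0
  simp only [zero_add] at s1 s2
  have hall : ∑' n, q ^ n / qPoch (-q) q n = 2 - 1 / qPochInf (-q) q := by
    have h := (hasSum_pow_div_qPoch_succ hn hq).neg.tsum_eq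
    rw [s1.tsum_eq_zero_add, pow_zero, qPoch_zero, div_one,
      tsum_congr (g := fun n => -(-q * q ^ n / qPoch (-q) q (n + 1))) fun n => by ring, h]
    ring
  -- The difference cancels even indices and doubles odd ones.
  set f : ℕ → ℂ := fun n => q ^ n / qPoch (-q) q n - (-q) ^ n / qPoch (-q) q n with hf
  have he : ∀ n, f (2 * n) = 0 := by
    intro n
    simp only [hf]
    rw [(even_two_mul n).neg_pow, sub_self]
  have ho : ∀ n, f (2 * n + 1) = 2 * (q ^ (2 * n + 1) / qPoch (-q) q (2 * n + 1)) := by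
    intro n
    simp only [hf]
    rw [(odd_two_mul_add_one n).neg_pow]
    ring
  have s3 : Summable f := s1.sub s2
  have h3 : ∑' n, f n = 2 - 1 / qPochInf (-q) q - ∑' n, (-q) ^ n / qPoch (-q) q n := by
    rw [← hall]
    exact s1.tsum_sub s2
  have h4 := tsum_even_add_odd
    (s3.comp_injective (i := fun n => 2 * n) fun a b hab => by simpa using hab)
    (s3.comp_injective (i := fun n => 2 * n + 1) fun a b hab => by simpa using hab)
  simp only [he, ho, tsum_zero, zero_add, tsum_mul_left] at h4
  rw [h4, h3]

theorem Fedou_neg_eq {q : ℂ} (hq : ‖q‖ < 1) (hq0 : q ≠ 0) :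
    Fedou (-q) = -(qPochInf (-q ^ 2) (q ^ 2) / 2) *
      (2 - 1 / qPochInf (-q) q - 2 / qPochInf q q * ∑' n : ℤ, appellTerm q n) := by
  rw [← tsum_neg_pow_div_qPoch hq hq0, ← tsum_odd_pow_div_qPoch hq, Fedou,
    tsum_congr (edouTerm_neg hq), tsum_mul_left]
  ring

theorem theorem1p1 (q : ℂ) (hq : ‖q‖ < 1) :
    (Summable (odedTerm q) ∧
      Foded q = q * qPochInf (-q) (q ^ 2) / (1 - q) *
        (1 - qPochInf (-q ^ 2) (q ^ 2) / qPochInf (-q) (q ^ 2))) ∧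
    (Summable (edodTerm q) ∧
      Fedod q = q * qPochInf (-q ^ 2) (q ^ 2) / (1 - q) *
        (2 - qPochInf (-q) (q ^ 2) / qPochInf (-q ^ 2) (q ^ 2))) ∧
    (Summable (edouTerm (-q)) ∧
      (q ≠ 0 → Summable (appellTerm q) ∧
        Fedou (-q) = -(qPochInf (-q ^ 2) (q ^ 2) / 2) *
          (2 - 1 / qPochInf (-q) q -
            2 / qPochInf q q * ∑' n : ℤ, appellTerm q n))) :=
  ⟨⟨summable_odedTerm hq, Foded_eq hq⟩, ⟨summable_edodTerm hq, Fedod_eq hq⟩,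
    summable_edouTerm_neg hq, fun hq0 => ⟨(summable_appellTerm_and_tsum_eq hq hq0).1, Fedou_neg_eq hq hq0⟩⟩
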